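/- Let $m,n$ be non-negative integers, let $U\subseteq\mathbb{R}^n$ be non-empty and positive homogeneous (i.e. $\lambda u\in U$ for all $u\in U$ and $\lambda\ge 0$), and let $g:\mathbb{R}^n\to\mathbb{R}^m$ be a positive homogeneous function (i.e. $g(\lambda x)=\lambda g(x)$ for all $x\in\mathbb{R}^n$ and $\lambda\ge 0$). Let $\|\cdot\|_{II}$ be a norm on $\mathbb{R}^n$ with $\|\cdot\|_2\le\|\cdot\|_{II}$, and suppose that $$\tau:=\inf_{\substack{x^{(1)},x^{(2)}\in U\\ x^{(1)}\ne x^{(2)}}}\frac{\|g(x^{(1)})-g(x^{(2)})\|_2}{\|x^{(1)}-x^{(2)}\|_2}>0,\qquad \rho:=\sup_{\substack{x^{(1)},x^{(2)}\in\mathbb{R}^n\\ x^{(1)}\ne x^{(2)}}}\frac{\|g(x^{(1)})-g(x^{(2)})\|_2}{\|x^{(1)}-x^{(2)}\|_{II}}<\infty ,$$ where infimum and supremum are taken in $[0,\infty]$ (so $\tau=\infty$ if $U=\{0\}$, and then $1/\tau:=0$). Let $\delta\in(0,1)$. Then there is a function $f:\mathbb{R}^m\to\mathbb{R}^n$ represented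 by an unbiased ReLU network with two hidden layers, i.e. $f(y)=W_3\,\phi(W_2\,\phi(W_1y))$ for some widths $k_1,k_2$ and real matrices $W_1\in\mathbb{R}^{k_1\times m}$, $W_2\in\mathbb{R}^{k_2\times k_1}$, $W_3\in\mathbb{R}^{n\times k_2}$, with $\phi(t)=\max\{t,0\}$ applied componentwise, such that for all $x\in\mathbb{R}^n$ and $e\in\mathbb{R}^m$, $$\|f(g(x)+e)-x\|_2\le\delta\|x\|_2+\Bigl(1+\frac{2\rho}{\tau}\Bigr)d_{II}(x,U)+\frac{3}{\tau}\|e\|_2,\qquad\text{where } d_{II}(x,U):=\inf_{x'\in U}\|x-x'\|_{II}.$$ -/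

import Mathlib

open scoped ENNReal

/-- The rectified linear unit. -/
noncomputable def relu (t : ℝ) : ℝ := max t 0

/-- The parameters of a feedforward neural network with input dimension `m`, output dimension `n`
and `d` hidden layers: `hidden W b N` is the network whose first (hidden) layer has weight matrix
`W` and bias `b`, of arbitrary width `k`, and whose remaining layers are those of `N`; `output W b`
is the final affine layer. -/
inductive FeedforwardNetwork : (m n d : ℕ) → Type
  | output {m n : ℕ} (W : Matrix (Fin n) (Fin m) ℝ) (b : Fin n → ℝ) : FeedforwardNetwork m n 0
  | hidden {m n d k : ℕ} (W : Matrix (Fin k) (Fin m) ℝ) (b : Fin k → ℝ)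
      (N : FeedforwardNetwork k n d) : FeedforwardNetwork m n (d + 1)

namespace FeedforwardNetwork

/-- The function `x ↦ W_{d+1} σ(W_d σ(⋯ σ(W_1 x + b_1) ⋯) + b_d) + b_{d+1}`, where the activation
function `σ` is applied componentwise. -/
def eval (σ : ℝ → ℝ) : {m n d : ℕ} → FeedforwardNetwork m n d → (Fin m → ℝ) → (Fin n → ℝ)
  | _, _, _, output W b, x => W.mulVec x + b
  | _, _, _, hidden W b N, x => N.eval σ (fun i => σ ((W.mulVec x + b) i))

/-- All biases vanish. -/
def IsUnbiased : {m n d : ℕ} → FeedforwardNetwork m n d → Prop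
  | _, _, _, output _ b => b = 0
  | _, _, _, hidden _ b N => b = 0 ∧ N.IsUnbiased

/-- The network `N` with activation function `σ` represents the map `f : ℝᵐ → ℝⁿ`. -/
def Represents {m n d : ℕ} (N : FeedforwardNetwork m n d) (σ : ℝ → ℝ)
    (f : EuclideanSpace ℝ (Fin m) → EuclideanSpace ℝ (Fin n)) : Prop :=
  ∀ x, f x = WithLp.toLp 2 (N.eval σ x.ofLp)

end FeedforwardNetwork

/-- `U` is a positive homogeneous set: closed under multiplication by all `c ∈ [0, ∞)`. -/
def IsPosHomogeneousSet {E : Type*} [SMul ℝ E] (U : Set E) : Prop :=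
  ∀ c : ℝ, 0 ≤ c → ∀ x ∈ U, c • x ∈ U

/-- `g` is a positive homogeneous map: `g (c x) = c g x` for all `c ∈ [0, ∞)`. -/
def IsPosHomogeneousMap {E F : Type*} [SMul ℝ E] [SMul ℝ F] (g : E → F) : Prop :=
  ∀ c : ℝ, 0 ≤ c → ∀ x, g (c • x) = c • g x

/-- The infimum of `‖g x - g y‖ / ‖x - y‖` over distinct `x, y ∈ U`, in `[0, ∞]`
(it is `∞` if `U` has at most one point). -/
noncomputable def lowerLipschitzBound {E F : Type*} [NormedAddCommGroup E] [NormedAddCommGroup F]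
    (g : E → F) (U : Set E) : ℝ≥0∞ :=
  ⨅ (x ∈ U) (y ∈ U) (_ : x ≠ y), ENNReal.ofReal (‖g x - g y‖ / ‖x - y‖)

/-- The supremum of `‖g x - g y‖ / p (x - y)` over distinct `x, y`, in `[0, ∞]`, where `p` is a
norm on the domain (it is `0` if the domain has at most one point). -/
noncomputable def upperLipschitzBound {E F : Type*} [AddCommGroup E] [Module ℝ E]
    [NormedAddCommGroup F] (g : E → F) (p : Seminorm ℝ E) : ℝ≥0∞ :=
  ⨆ (x : E) (y : E) (_ : x ≠ y), ENNReal.ofReal (‖g x - g y‖ / p (x - y))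

/-- The distance `inf_{u ∈ U} p (x - u)` of `x` to the (non-empty) set `U` in the norm `p`. -/
noncomputable def normDistance {E : Type*} [AddCommGroup E] [Module ℝ E]
    (p : Seminorm ℝ E) (x : E) (U : Set E) : ℝ :=
  ⨅ u : U, p (x - u)

/-! On `U` the map `g` has an inverse with Lipschitz constant `T = 1/τ`. Sending `y` to a point `u`
of `U` with `g u` nearly closest to `y` gives error at most `2T‖y - g x‖` plus a small term, against
every `x ∈ U` at once. These conditions on the value are convex, so a partition of unity makes the
choice continuous (`exists_continuous_near_inverse`). Universal approximation replaces it by a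
network on the `ℓ¹` sphere. There the constant `1` equals `∑ |y i|`, which a first ReLU layer
supplies, so the biases disappear and the network is positive homogeneous
(`exists_unbiased_approx`). Rescaling carries the bound to all `y`, and the triangle inequality
through `u ∈ U` finishes. -/

theorem continuous_relu : Continuous relu := continuous_id.max continuous_const

theorem relu_of_nonneg {t : ℝ} (ht : 0 ≤ t) : relu t = t := max_eq_left ht

theorem relu_of_nonpos {t : ℝ} (ht : t ≤ 0) : relu t = 0 := max_eq_right ht

theorem relu_mul {c : ℝ} (hc : 0 ≤ c) (t : ℝ) : relu (c * t) = c * relu t := by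
  simp [relu, mul_max_of_nonneg _ _ hc]

theorem relu_sub_relu_neg (t : ℝ) : relu t - relu (-t) = t := by
  rcases le_total 0 t with h | h
  · rw [relu_of_nonneg h, relu_of_nonpos (by linarith)]; ring
  · rw [relu_of_nonpos h, relu_of_nonneg (by linarith)]; ring

theorem relu_add_relu_neg (t : ℝ) : relu t + relu (-t) = |t| := by
  rcases le_total 0 t with h | h
  · rw [relu_of_nonneg h, relu_of_nonpos (by linarith), abs_of_nonneg h]; ring
  · rw [relu_of_nonpos h, relu_of_nonneg (by linarith), abs_of_nonpos h]; ring

/-! ### Piecewise linear interpolation on an interval -/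

/-- The function `t ↦ relu (a t + b)`. -/
noncomputable def reluAffine (p : ℝ × ℝ) : C(ℝ, ℝ) :=
  ⟨fun t => relu (p.1 * t + p.2), continuous_relu.comp (by fun_prop)⟩

/-- Piecewise linear interpolation: on a compact interval, every continuous function is a uniform
limit of linear combinations of functions `t ↦ relu (a t + b)`. -/
theorem exists_mem_span_reluAffine_approx {h : ℝ → ℝ} (hh : Continuous h) {a b : ℝ} (hab : a < b)
    {ε : ℝ} (hε : 0 < ε) :
    ∃ P ∈ Submodule.span ℝ (Set.range reluAffine), ∀ t ∈ Set.Icc a b, |P t - h t| ≤ ε := by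
  obtain ⟨d, hd, hdist⟩ := Metric.uniformContinuousOn_iff.1
    (isCompact_Icc.uniformContinuousOn_of_continuous (s := Set.Icc a b) hh.continuousOn) ε hε
  obtain ⟨N, hN⟩ := exists_nat_gt ((b - a) / d)
  have hN0 : (0 : ℝ) < N := lt_trans (div_pos (sub_pos.2 hab) hd) hN
  obtain ⟨η, hη⟩ : ∃ η, η = (b - a) / N := ⟨_, rfl⟩
  have hη0 : 0 < η := hη ▸ div_pos (sub_pos.2 hab) hN0
  have hηd : η < d := by
    rw [hη, div_lt_iff₀ hN0]
    rw [div_lt_iff₀ hd] at hN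
    linarith
  have hNη : N * η = b - a := by rw [hη]; field_simp
  -- Induction over the grid nodes: keeping `P` constant to the right of the last node lets the next
  -- ramp be added without disturbing earlier pieces.
  have key : ∀ j : ℕ, j ≤ N → ∃ P ∈ Submodule.span ℝ (Set.range reluAffine),
      (∀ t ∈ Set.Icc a (a + j * η), |P t - h t| ≤ ε) ∧
      ∀ t, a + j * η ≤ t → P t = h (a + j * η) := by
    intro j
    induction j with
    | zero =>
      intro _
      have hP : ∀ t, (h a • reluAffine (0, 1)) t = h a := by
        intro t
        simp [reluAffine, relu]
      refine ⟨h a • reluAffine (0, 1),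
        Submodule.smul_mem _ _ (Submodule.subset_span ⟨_, rfl⟩), ?_, ?_⟩
      · intro t ht
        have : t = a := by
          have := ht.1; have := ht.2
          push_cast at this
          linarith
        rw [hP, this]
        simpa using hε.le
      · intro t _
        rw [hP]
        simp
    | succ j ih =>
      intro hj
      obtain ⟨P, hP, hP1, hP2⟩ := ih (by omega)
      have hjN : ((j : ℝ) + 1) * η ≤ b - a := by
        rw [← hNη]
        exact mul_le_mul_of_nonneg_right (by exact_mod_cast hj) hη0.le
      have hj0 : 0 ≤ (j : ℝ) * η := by positivity
      obtain ⟨u, hu⟩ : ∃ u, u = a + j * η := ⟨_, rfl⟩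
      have hv : a + ((j + 1 : ℕ) : ℝ) * η = u + η := by rw [hu]; push_cast; ring
      rw [← hu] at hP1 hP2
      rw [hv]
      have hQ : ∀ t, (P + ((h (u + η) - h u) / η) •
          (reluAffine (1, -u) - reluAffine (1, -(u + η)))) t =
          P t + (h (u + η) - h u) / η * (relu (t - u) - relu (t - (u + η))) := by
        intro t
        simp [reluAffine, sub_eq_add_neg]
        ring
      refine ⟨_, Submodule.add_mem _ hP (Submodule.smul_mem _ ((h (u + η) - h u) / η)
        (Submodule.sub_mem _ (Submodule.subset_span ⟨(1, -u), rfl⟩)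
          (Submodule.subset_span ⟨(1, -(u + η)), rfl⟩))), ?_, ?_⟩
      · intro t ht
        rw [hQ, relu_of_nonpos (t := t - (u + η)) (by linarith [ht.2])]
        rcases le_total t u with htu | htu
        · rw [relu_of_nonpos (by linarith)]
          simpa using hP1 t ⟨ht.1, htu⟩
        · rw [hP2 t htu, relu_of_nonneg (by linarith)]
          have htm : t ∈ Set.Icc a b := ⟨ht.1, by linarith [ht.2]⟩
          have h1 := hdist u ⟨by linarith, by linarith⟩ t htm (by
            rw [Real.dist_eq, abs_lt]; constructor <;> linarith [ht.2])
          have h2 := hdist (u + η) ⟨by linarith, by linarith⟩ t htm (by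
            rw [Real.dist_eq, abs_lt]; constructor <;> linarith [ht.2])
          rw [Real.dist_eq, abs_lt] at h1 h2
          obtain ⟨l, hl⟩ : ∃ l, l = (t - u) / η := ⟨_, rfl⟩
          have hl0 : 0 ≤ l := hl ▸ div_nonneg (by linarith) hη0.le
          have hl1 : l ≤ 1 := by rw [hl, div_le_one hη0]; linarith [ht.2]
          -- The error is a convex combination of two oscillations of `h` over less than `d`.
          have e : h u + (h (u + η) - h u) / η * (t - u - 0) - h t =
              (1 - l) * (h u - h t) + l * (h (u + η) - h t) := by
            rw [hl]; field_simp; ring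
          rw [e, abs_le]
          constructor <;> nlinarith
      · intro t ht
        rw [hQ, hP2 t (by linarith), relu_of_nonneg (by linarith), relu_of_nonneg (by linarith)]
        field_simp
        ring
  obtain ⟨P, hP, hP1, -⟩ := key N le_rfl
  exact ⟨P, hP, fun t ht => hP1 t (by rwa [hNη, add_sub_cancel])⟩

/-! ### Density of ReLU ridge functions -/

section Ridge

variable {E : Type*} [NormedAddCommGroup E] [InnerProductSpace ℝ E]

/-- The restriction of `y ↦ relu (⟪w, y⟫ + b)` to `K`. -/
noncomputable def reluRidge (K : Set E) (p : E × ℝ) : C(K, ℝ) :=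
  ⟨fun y => relu (inner ℝ p.1 (y : E) + p.2), continuous_relu.comp (by fun_prop)⟩

/-- The restriction of `y ↦ exp ⟪w, y⟫` to `K`. -/
noncomputable def expRidge (K : Set E) (w : E) : C(K, ℝ) :=
  ⟨fun y => Real.exp (inner ℝ w (y : E)), by fun_prop⟩

/-- On compact `K` the inner product with `w` takes bounded values, so one-dimensional interpolation
of `exp` can be composed with it. -/
theorem expRidge_mem_closure (K : Set E) [CompactSpace K] (w : E) :
    expRidge K w ∈ (Submodule.span ℝ (Set.range (reluRidge K))).topologicalClosure := by
  let L : C(K, ℝ) := ⟨fun y => inner ℝ w (y : E), by fun_prop⟩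
  rw [← SetLike.mem_coe, Submodule.topologicalClosure_coe, Metric.mem_closure_iff]
  intro ε hε
  obtain ⟨P, hP, hPε⟩ := exists_mem_span_reluAffine_approx Real.continuous_exp
    (a := -(‖L‖ + 1)) (b := ‖L‖ + 1) (by linarith [norm_nonneg L]) (half_pos hε)
  refine ⟨P.comp L, ?_, ?_⟩
  · have : Submodule.span ℝ (Set.range reluAffine) ≤
        (Submodule.span ℝ (Set.range (reluRidge K))).comap
          (ContinuousMap.compRightAlgHom ℝ ℝ L).toLinearMap := by
      rw [Submodule.span_le]
      rintro _ ⟨p, rfl⟩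
      refine Submodule.subset_span ⟨(p.1 • w, p.2), ?_⟩
      ext y
      simp [reluRidge, reluAffine, L, inner_smul_left]
    exact this hP
  · refine lt_of_le_of_lt ?_ (half_lt_self hε)
    rw [ContinuousMap.dist_le (half_pos hε).le]
    intro y
    have := L.norm_coe_le_norm y
    rw [Real.norm_eq_abs, abs_le] at this
    rw [dist_comm, Real.dist_eq]
    exact hPε _ ⟨by linarith, by linarith⟩

/-- Universal approximation by networks with one hidden layer. -/
theorem closure_span_reluRidge (K : Set E) [CompactSpace K] :
    (Submodule.span ℝ (Set.range (reluRidge K))).topologicalClosure = ⊤ := by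
  -- Exponentials are closed under products, so their span is already an algebra and
  -- Stone–Weierstrass applies to it.
  let M : Submonoid C(K, ℝ) :=
    { carrier := Set.range (expRidge K)
      one_mem' := ⟨0, by ext y; simp [expRidge]⟩
      mul_mem' := by
        rintro _ _ ⟨v, rfl⟩ ⟨w, rfl⟩
        exact ⟨v + w, by ext y; simp [expRidge, inner_add_left, Real.exp_add]⟩ }
  have hsep : (Algebra.adjoin ℝ (M : Set C(K, ℝ))).SeparatesPoints := by
    intro x y hxy
    refine ⟨_, ⟨expRidge K (x - y : E), Algebra.subset_adjoin ⟨_, rfl⟩, rfl⟩, ?_⟩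
    intro h
    have h1 : inner ℝ (x - y : E) (x : E) = inner ℝ (x - y : E) (y : E) := Real.exp_injective h
    rw [← sub_eq_zero, ← inner_sub_right, inner_self_eq_zero, sub_eq_zero] at h1
    exact hxy (Subtype.ext h1)
  have htop := ContinuousMap.subalgebra_topologicalClosure_eq_top_of_separatesPoints _ hsep
  rw [eq_top_iff]
  intro f _
  have hf : f ∈ closure ((Algebra.adjoin ℝ (M : Set C(K, ℝ)) : Set C(K, ℝ))) := by
    rw [← Subalgebra.topologicalClosure_coe, htop]
    trivial
  refine closure_minimal ?_ (Submodule.isClosed_topologicalClosure _) hf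
  intro q hq
  rw [SetLike.mem_coe, ← Subalgebra.mem_toSubmodule, Algebra.adjoin_eq_span,
    Submonoid.closure_eq] at hq
  refine (Submodule.span_le.2 ?_ : Submodule.span ℝ (M : Set C(K, ℝ)) ≤ _) hq
  rintro _ ⟨w, rfl⟩
  exact expRidge_mem_closure K w

theorem exists_sum_relu_approx {K : Set E} (hK : IsCompact K) {h : E → ℝ} (hh : Continuous h)
    {ε : ℝ} (hε : 0 < ε) :
    ∃ (k : ℕ) (w : Fin k → E) (b c : Fin k → ℝ),
      ∀ y ∈ K, |∑ j, c j * relu (inner ℝ (w j) y + b j) - h y| ≤ ε := by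
  have := isCompact_iff_compactSpace.1 hK
  let h' : C(K, ℝ) := ⟨fun y => h y, by fun_prop⟩
  have hmem : h' ∈ closure (Submodule.span ℝ (Set.range (reluRidge K)) : Set C(K, ℝ)) := by
    rw [← Submodule.topologicalClosure_coe, closure_span_reluRidge]
    trivial
  obtain ⟨q, hq, hqd⟩ := Metric.mem_closure_iff.1 hmem ε hε
  obtain ⟨k, c, p, rfl⟩ := Submodule.mem_span_set'.1 hq
  choose r hr using fun j => (p j).2
  refine ⟨k, fun j => (r j).1, fun j => (r j).2, c, fun y hy => ?_⟩
  have := (ContinuousMap.dist_lt_iff hε).1 hqd ⟨y, hy⟩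
  rw [dist_comm, Real.dist_eq] at this
  refine le_of_eq_of_le ?_ this.le
  simp only [← hr, ContinuousMap.coe_sum, Finset.sum_apply, ContinuousMap.coe_smul, Pi.smul_apply,
    smul_eq_mul]
  rfl

end Ridge

/-! ### Unbiased networks -/

namespace FeedforwardNetwork

/-- Unbiased networks with two hidden layers whose neurons are indexed by finite types. -/
theorem exists_unbiased_represents {m n : ℕ} {α β : Type*} [Fintype α] [Fintype β] (σ : ℝ → ℝ)
    (W₁ : Matrix α (Fin m) ℝ) (W₂ : Matrix β α ℝ) (W₃ : Matrix (Fin n) β ℝ) :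
    ∃ N : FeedforwardNetwork m n 2, N.IsUnbiased ∧ N.Represents σ fun y =>
      WithLp.toLp 2 (W₃.mulVec (σ ∘ W₂.mulVec (σ ∘ W₁.mulVec y.ofLp))) := by
  let eα := (Fintype.equivFin α).symm
  let eβ := (Fintype.equivFin β).symm
  refine ⟨hidden (W₁.submatrix eα (Equiv.refl _)) 0 (hidden (W₂.submatrix eβ eα) 0
    (output (W₃.submatrix (Equiv.refl _) eβ) 0)), ⟨rfl, rfl, rfl⟩, fun y => ?_⟩
  simp only [eval, add_zero, Matrix.submatrix_mulVec_equiv, Function.comp_def,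
    Equiv.apply_symm_apply, Equiv.refl_apply, Equiv.refl_symm]

/-- Two hidden layers without biases compute the functions of one hidden layer in which the `ℓ¹`
norm of the input takes the place of the constant that carries the biases. -/
theorem exists_unbiased_represents_sum {m n : ℕ} {ι : Type*} [Fintype ι]
    (w : ι → EuclideanSpace ℝ (Fin m)) (b : ι → ℝ) (c : ι → EuclideanSpace ℝ (Fin n)) :
    ∃ N : FeedforwardNetwork m n 2, N.IsUnbiased ∧ N.Represents relu fun y =>
      ∑ j, relu (inner ℝ (w j) y + b j * ∑ i, |y i|) • c j := by
  obtain ⟨N, hN, hrep⟩ := exists_unbiased_represents relu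
    -- The first layer outputs the positive and negative parts of each `y i`: their difference is `y
    -- i`, their sum `|y i|`.
    (Matrix.of (Sum.elim (fun i : Fin m => Pi.single i (1 : ℝ)) fun i => -Pi.single i (1 : ℝ)))
    (Matrix.of fun j => Sum.elim (fun i => w j i + b j) fun i => -w j i + b j)
    (Matrix.of fun (l : Fin n) (j : ι) => c j l)
  refine ⟨N, hN, fun y => ?_⟩
  rw [← hrep y]
  ext l
  simp only [Matrix.mulVec, dotProduct, Matrix.of_apply, Function.comp_apply, Fintype.sum_sum_type,
    Sum.elim_inl, Sum.elim_inr, WithLp.ofLp_sum, WithLp.ofLp_smul, Finset.sum_apply, Pi.smul_apply,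
    smul_eq_mul, Pi.neg_apply, neg_mul, Finset.sum_neg_distrib, Pi.single_apply, ite_mul, one_mul,
    zero_mul, Finset.sum_ite_eq', Finset.mem_univ, if_true]
  refine Finset.sum_congr rfl fun j _ => ?_
  rw [mul_comm]
  congr 2
  rw [PiLp.inner_apply, Finset.mul_sum, ← Finset.sum_add_distrib, ← Finset.sum_add_distrib]
  refine Finset.sum_congr rfl fun i _ => ?_
  conv_lhs => rw [← relu_add_relu_neg (y i)]
  have := relu_sub_relu_neg (y i)
  simp only [RCLike.inner_apply, conj_trivial]
  linear_combination (-w j i) * this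

/-- A continuous function is approximated uniformly on the `ℓ¹` sphere by a positive homogeneous
function that an unbiased network with two hidden layers represents. -/
theorem exists_unbiased_approx {m n : ℕ} {F : EuclideanSpace ℝ (Fin m) → EuclideanSpace ℝ (Fin n)}
    (hF : Continuous F) {ε : ℝ} (hε : 0 < ε) :
    ∃ (f : EuclideanSpace ℝ (Fin m) → EuclideanSpace ℝ (Fin n)) (N : FeedforwardNetwork m n 2),
      N.IsUnbiased ∧ N.Represents relu f ∧ IsPosHomogeneousMap f ∧
      ∀ y, ∑ i, |y i| = 1 → ‖f y - F y‖ ≤ ε := by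
  have hK : IsCompact {y : EuclideanSpace ℝ (Fin m) | ∑ i, |y i| = 1} := by
    refine Metric.isCompact_of_isClosed_isBounded
      (isClosed_eq (by fun_prop) continuous_const) ?_
    refine isBounded_iff_forall_norm_le.2 ⟨1, fun y hy => ?_⟩
    rw [Set.mem_ofPred_eq] at hy
    rw [EuclideanSpace.norm_eq, Real.sqrt_le_one]
    calc ∑ i, ‖y i‖ ^ 2 ≤ (∑ i, ‖y i‖) ^ 2 :=
          Finset.sum_sq_le_sq_sum_of_nonneg fun i _ => norm_nonneg _
      _ = 1 := by simp only [Real.norm_eq_abs, hy, one_pow]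
  have hn : (0 : ℝ) < n + 1 := by positivity
  choose k w b c happ using fun l : Fin n => exists_sum_relu_approx hK
    (h := fun y => F y l) (by fun_prop) (div_pos hε hn)
  obtain ⟨N, hN, hrep⟩ := exists_unbiased_represents_sum
    (ι := Σ l : Fin n, Fin (k l)) (fun j => w j.1 j.2) (fun j => b j.1 j.2)
    (fun j => c j.1 j.2 • EuclideanSpace.single j.1 (1 : ℝ))
  refine ⟨_, N, hN, hrep, ?_, ?_⟩
  · intro r hr y
    rw [Finset.smul_sum]
    refine Finset.sum_congr rfl fun j _ => ?_
    rw [smul_smul r, ← relu_mul hr]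
    congr 2
    simp only [inner_smul_right, PiLp.smul_apply, smul_eq_mul, abs_mul, abs_of_nonneg hr,
      ← Finset.mul_sum]
    ring
  · intro y hy
    have hcoord : ∀ v : EuclideanSpace ℝ (Fin n), (∀ l, |v l| ≤ ε / (n + 1)) → ‖v‖ ≤ ε := by
      intro v hv
      calc ‖v‖ = ‖∑ l, EuclideanSpace.single l (v l)‖ := by
            congr 1
            ext l
            simp [Finset.sum_apply, Pi.single_apply]
        _ ≤ ∑ l, ‖EuclideanSpace.single l (v l)‖ := norm_sum_le _ _
        _ ≤ ∑ _l : Fin n, ε / (n + 1) := Finset.sum_le_sum fun l _ => by simpa using hv l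
        _ = n * (ε / (n + 1)) := by simp
        _ ≤ ε := by
            rw [mul_div_assoc', div_le_iff₀ hn]
            nlinarith
    refine hcoord _ fun l => le_of_eq_of_le ?_ (happ l y hy)
    congr 1
    simp only [hy, mul_one, PiLp.sub_apply, WithLp.ofLp_sum, Finset.sum_apply, WithLp.ofLp_smul,
      Pi.smul_apply, smul_eq_mul, Fintype.sum_sigma, PiLp.single_apply, sub_left_inj]
    rw [Finset.sum_eq_single l]
    · refine Finset.sum_congr rfl fun j _ => ?_
      simp [mul_comm]
    · intro l' _ hl'
      simp [hl'.symm]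
    · simp

end FeedforwardNetwork

/-! ### Continuous near-inverse -/

section Selection

variable {E F : Type*} [NormedAddCommGroup E] [NormedAddCommGroup F]

/-- The inverse constant also covers the bound `∞`, where it is `0` and `U` has at most one point.
-/
theorem norm_sub_le_of_lowerLipschitzBound {g : E → F} {U : Set E}
    (hτ : 0 < lowerLipschitzBound g U) {x y : E} (hx : x ∈ U) (hy : y ∈ U) :
    ‖x - y‖ ≤ (lowerLipschitzBound g U)⁻¹.toReal * ‖g x - g y‖ := by
  by_cases hxy : x = y
  · simp [hxy]
  have hle : lowerLipschitzBound g U ≤ ENNReal.ofReal (‖g x - g y‖ / ‖x - y‖) :=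
    iInf₂_le_of_le x hx (iInf₂_le_of_le y hy (iInf_le _ hxy))
  have hd : 0 < ‖x - y‖ := norm_pos_iff.2 (sub_ne_zero.2 hxy)
  have htop : lowerLipschitzBound g U ≠ ∞ := ne_top_of_le_ne_top ENNReal.ofReal_ne_top hle
  have hpos := ENNReal.toReal_pos hτ.ne' htop
  rw [ENNReal.toReal_inv, inv_mul_eq_div, le_div_iff₀ hpos, mul_comm, ← le_div_iff₀ hd]
  exact ENNReal.toReal_le_of_le_ofReal (by positivity) hle

theorem norm_sub_le_of_upperLipschitzBound [Module ℝ E] {g : E → F} {p : Seminorm ℝ E}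
    (hp : ∀ x, ‖x‖ ≤ p x) (hρ : upperLipschitzBound g p < ∞) (x y : E) :
    ‖g x - g y‖ ≤ (upperLipschitzBound g p).toReal * p (x - y) := by
  by_cases hxy : x = y
  · simp [hxy]
  have hd : 0 < p (x - y) := (norm_pos_iff.2 (sub_ne_zero.2 hxy)).trans_le (hp _)
  rw [← div_le_iff₀ hd]
  refine (ENNReal.ofReal_le_iff_le_toReal hρ.ne).1 ?_
  exact le_iSup₂_of_le x y (le_iSup_of_le hxy le_rfl)

/-- A continuous approximation of the (multivalued) map that sends `y` to the points of `U` whose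
image under `g` is nearest to `y`. -/
theorem exists_continuous_near_inverse [NormedSpace ℝ E] {g : E → F} {U : Set E}
    (hU : U.Nonempty) {T : ℝ} (hT : 0 ≤ T)
    (hTg : ∀ x ∈ U, ∀ y ∈ U, ‖x - y‖ ≤ T * ‖g x - g y‖) {ε : ℝ} (hε : 0 < ε) :
    ∃ G : F → E, Continuous G ∧ ∀ y, ∀ x ∈ U, ‖G y - x‖ ≤ 2 * T * ‖y - g x‖ + ε := by
  obtain ⟨η, hη, hηε⟩ : ∃ η, 0 < η ∧ T * (3 * η) ≤ ε := by
    refine ⟨ε / (3 * (T + 1)), by positivity, ?_⟩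
    rw [mul_div_assoc', mul_div_assoc', div_le_iff₀ (by positivity)]
    nlinarith
  obtain ⟨G, hG⟩ := exists_continuous_forall_mem_convex_of_local_const
    (t := fun y : F => ⋂ x ∈ U, Metric.closedBall x (2 * T * ‖y - g x‖ + ε))
    (fun y => convex_iInter₂ fun x _ => convex_closedBall _ _) (by
      intro y
      obtain ⟨_, ⟨u, hu, rfl⟩, hlt⟩ := (Metric.infDist_lt_iff (hU.image g)).1
        (lt_add_of_pos_right (Metric.infDist y (g '' U)) hη)
      -- The constant `u`, nearly optimal for `y`, also serves all `z` near `y`; the slack `3 * η`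
      -- is one `η` from near-optimality and two from replacing `y` by `z`.
      refine ⟨u, ?_⟩
      filter_upwards [Metric.ball_mem_nhds y hη] with z hz
      refine Set.mem_iInter₂.2 fun x hx => ?_
      rw [mem_closedBall_iff_norm]
      have h1 : ‖y - g u‖ ≤ ‖y - g x‖ + η := by
        have := Metric.infDist_le_dist_of_mem (x := y) (Set.mem_image_of_mem g hx)
        rw [dist_eq_norm] at this hlt
        linarith
      have h2 : ‖y - g x‖ ≤ η + ‖z - g x‖ := by
        rw [mem_ball_iff_norm'] at hz
        linarith [norm_sub_le_norm_sub_add_norm_sub y z (g x)]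
      have h3 : ‖g u - g x‖ ≤ ‖y - g u‖ + ‖y - g x‖ := by
        have := norm_sub_le_norm_sub_add_norm_sub (g u) y (g x)
        rwa [norm_sub_rev (g u) y] at this
      calc ‖u - x‖ ≤ T * ‖g u - g x‖ := hTg u hu x hx
        _ ≤ T * (2 * ‖z - g x‖ + 3 * η) := mul_le_mul_of_nonneg_left (by linarith) hT
        _ ≤ 2 * T * ‖z - g x‖ + ε := by linarith)
  refine ⟨G, G.continuous, fun y x hx => ?_⟩
  rw [← mem_closedBall_iff_norm]
  exact Set.mem_iInter₂.1 (hG y) x hx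

end Selection

/-! ### Homogeneous inversion and the final estimate -/

/-- The robust inversion of `g` on the cone `U` by an unbiased network with two hidden layers. -/
theorem exists_unbiased_near_inverse {m n : ℕ}
    {U : Set (EuclideanSpace ℝ (Fin n))} (hU_nonempty : U.Nonempty) (hU : IsPosHomogeneousSet U)
    {g : EuclideanSpace ℝ (Fin n) → EuclideanSpace ℝ (Fin m)} (hg : IsPosHomogeneousMap g)
    {T : ℝ} (hT : 0 ≤ T) (hTg : ∀ x ∈ U, ∀ y ∈ U, ‖x - y‖ ≤ T * ‖g x - g y‖)
    {ε : ℝ} (hε : 0 < ε) :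
    ∃ (f : EuclideanSpace ℝ (Fin m) → EuclideanSpace ℝ (Fin n)) (N : FeedforwardNetwork m n 2),
      N.IsUnbiased ∧ N.Represents relu f ∧
      ∀ y, ∀ x ∈ U, ‖f y - x‖ ≤ 2 * T * ‖y - g x‖ + ε * ‖y‖ := by
  have hm : (0 : ℝ) < m + 1 := by positivity
  -- One `η` pays for the selection, one for the network; `m` bounds the `ℓ¹` norm by the Euclidean
  -- one.
  obtain ⟨η, hη, hηε⟩ : ∃ η, 0 < η ∧ 2 * η * m ≤ ε := by
    refine ⟨ε / (2 * (m + 1)), by positivity, ?_⟩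
    rw [mul_div_assoc', div_mul_eq_mul_div, div_le_iff₀ (by positivity)]
    nlinarith
  obtain ⟨G, hG, hGU⟩ := exists_continuous_near_inverse hU_nonempty hT hTg hη
  obtain ⟨f, N, hN, hrep, hf, hfG⟩ := FeedforwardNetwork.exists_unbiased_approx hG hη
  refine ⟨f, N, hN, hrep, fun y x hx => ?_⟩
  obtain ⟨s, hs⟩ : ∃ s, s = ∑ i, |y i| := ⟨_, rfl⟩
  have hsy : s ≤ m * ‖y‖ := by
    calc s ≤ ∑ _i : Fin m, ‖y‖ := hs ▸ Finset.sum_le_sum fun i _ => PiLp.norm_apply_le y i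
      _ = m * ‖y‖ := by simp
  have hs0 : 0 ≤ s := hs ▸ Finset.sum_nonneg fun i _ => abs_nonneg _
  rcases hs0.eq_or_lt with h0 | hpos
  · have hy : y = 0 := by
      ext i
      have := (Finset.sum_eq_zero_iff_of_nonneg fun i _ => abs_nonneg (y i)).1 (hs ▸ h0.symm) i
        (Finset.mem_univ i)
      simpa using this
    have hf0 : f 0 = 0 := by simpa using hf 0 le_rfl 0
    have hg0 : g 0 = 0 := by simpa using hg 0 le_rfl 0
    have := hTg 0 (by simpa using hU 0 le_rfl x hx) x hx
    rw [hg0] at this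
    rw [hy, hf0, norm_zero, mul_zero, add_zero]
    nlinarith [norm_nonneg (0 - g x), mul_nonneg hT (norm_nonneg (0 - g x))]
  · have hinv : 0 ≤ s⁻¹ := (inv_pos.2 hpos).le
    have h1 : ∑ i, |(s⁻¹ • y) i| = 1 := by
      simp only [PiLp.smul_apply, smul_eq_mul, abs_mul, abs_of_nonneg hinv, ← Finset.mul_sum, ← hs]
      exact inv_mul_cancel₀ hpos.ne'
    have h2 := hfG _ h1
    have h3 := hGU (s⁻¹ • y) _ (hU s⁻¹ hinv x hx)
    have h4 := norm_sub_le_norm_sub_add_norm_sub (f (s⁻¹ • y)) (G (s⁻¹ • y)) (s⁻¹ • x)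
    rw [hg _ hinv, ← smul_sub, norm_smul, Real.norm_of_nonneg hinv] at h3
    rw [hf _ hinv, ← smul_sub, norm_smul, Real.norm_of_nonneg hinv] at h4
    have h5 : s⁻¹ * ‖f y - x‖ ≤ 2 * T * (s⁻¹ * ‖y - g x‖) + 2 * η := by
      rw [← hf _ hinv] at h4
      linarith
    have h6 : ‖f y - x‖ ≤ 2 * T * ‖y - g x‖ + 2 * η * s := by
      have := mul_le_mul_of_nonneg_left h5 hs0
      have e1 : s * (s⁻¹ * ‖f y - x‖) = ‖f y - x‖ := by field_simp
      have e2 : s * (2 * T * (s⁻¹ * ‖y - g x‖) + 2 * η) = 2 * T * ‖y - g x‖ + 2 * η * s := by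
        field_simp
      linarith
    have h7 : 2 * η * s ≤ ε * ‖y‖ := by
      nlinarith [mul_le_mul_of_nonneg_left hsy hη.le, mul_le_mul_of_nonneg_right hηε (norm_nonneg y)]
    linarith

theorem mainTheorem4 (m n : ℕ)
    (U : Set (EuclideanSpace ℝ (Fin n))) (hU_nonempty : U.Nonempty)
    (hU : IsPosHomogeneousSet U)
    (g : EuclideanSpace ℝ (Fin n) → EuclideanSpace ℝ (Fin m)) (hg : IsPosHomogeneousMap g)
    -- a seminorm that dominates the Euclidean norm is a norm
    (normII : Seminorm ℝ (EuclideanSpace ℝ (Fin n))) (h_normII : ∀ x, ‖x‖ ≤ normII x)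
    (τ ρ : ℝ≥0∞) (hτ_def : τ = lowerLipschitzBound g U) (hτ : 0 < τ)
    (hρ_def : ρ = upperLipschitzBound g normII) (hρ : ρ < ∞)
    (δ : ℝ) (hδ : δ ∈ Set.Ioo (0 : ℝ) 1) :
    ∃ (f : EuclideanSpace ℝ (Fin m) → EuclideanSpace ℝ (Fin n)) (N : FeedforwardNetwork m n 2),
      N.IsUnbiased ∧ N.Represents relu f ∧
      ∀ (x : EuclideanSpace ℝ (Fin n)) (e : EuclideanSpace ℝ (Fin m)),
        ‖f (g x + e) - x‖ ≤
          δ * ‖x‖ + (1 + 2 * (ρ / τ).toReal) * normDistance normII x U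
            + (3 / τ).toReal * ‖e‖ := by
  subst hτ_def hρ_def
  have hT' := fun x hx y hy => norm_sub_le_of_lowerLipschitzBound hτ (x := x) (y := y) hx hy
  have hR' := norm_sub_le_of_upperLipschitzBound h_normII hρ
  rw [div_eq_mul_inv, div_eq_mul_inv, ENNReal.toReal_mul, ENNReal.toReal_mul, ENNReal.toReal_ofNat]
  have hT0' : 0 ≤ (lowerLipschitzBound g U)⁻¹.toReal := ENNReal.toReal_nonneg
  have hR0' : 0 ≤ (upperLipschitzBound g normII).toReal := ENNReal.toReal_nonneg
  generalize (lowerLipschitzBound g U)⁻¹.toReal = T at *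
  generalize (upperLipschitzBound g normII).toReal = R at *
  have hg0 : g 0 = 0 := by simpa using hg 0 le_rfl 0
  have hcont : Continuous normII := by
    exact continuousOn_univ.1 (normII.convexOn.continuousOn isOpen_univ)
  obtain ⟨C, hC, hpC⟩ := normII.bound_of_continuous_normedSpace hcont
  have hgx : ∀ x, ‖g x‖ ≤ R * C * ‖x‖ := fun x => by
    have := hR' x 0
    rw [hg0, sub_zero, sub_zero] at this
    nlinarith [mul_le_mul_of_nonneg_left (hpC x) hR0']
  -- The term `ε * ‖g x + e‖` splits into at most `δ * ‖x‖` and `T * ‖e‖`; the latter raises `2 * T`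
  -- to `3 * T`. If `T = 0`, then `U = {0}` and the zero network is exact there.
  obtain ⟨f, N, hN, hrep, ε, hε0, hεT, hεδ, hf⟩ : ∃ (f : EuclideanSpace ℝ (Fin m) →
      EuclideanSpace ℝ (Fin n)) (N : FeedforwardNetwork m n 2), N.IsUnbiased ∧
      N.Represents relu f ∧ ∃ ε, 0 ≤ ε ∧ ε ≤ T ∧ ε * (R * C) ≤ δ ∧
      ∀ y, ∀ x ∈ U, ‖f y - x‖ ≤ 2 * T * ‖y - g x‖ + ε * ‖y‖ := by
    rcases hT0'.eq_or_lt with h0 | hpos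
    · obtain ⟨N, hN, hrep⟩ := FeedforwardNetwork.exists_unbiased_represents_sum
        (m := m) (n := n) (ι := Fin 0) (fun _ => 0) (fun _ => 0) (fun _ => 0)
      refine ⟨_, N, hN, hrep, 0, le_rfl, hT0', by simpa using hδ.1.le, fun y x hx => ?_⟩
      have := hT' 0 (by simpa using hU 0 le_rfl x hx) x hx
      rw [← h0] at this ⊢
      simpa using this
    · have hRC : 0 ≤ R * C := by positivity
      obtain ⟨f, N, hN, hrep, hf⟩ := exists_unbiased_near_inverse hU_nonempty hU hg hT0' hT'
        (lt_min hpos (div_pos hδ.1 (by positivity : 0 < R * C + 1)))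
      refine ⟨f, N, hN, hrep, _, (lt_min hpos (div_pos hδ.1 (by positivity))).le,
        min_le_left _ _, ?_, hf⟩
      calc _ ≤ δ / (R * C + 1) * (R * C) := mul_le_mul_of_nonneg_right (min_le_right _ _) hRC
        _ ≤ δ := by
          rw [div_mul_eq_mul_div, div_le_iff₀ (by positivity)]
          nlinarith [hδ.1]
  refine ⟨f, N, hN, hrep, fun x e => ?_⟩
  have : Nonempty U := hU_nonempty.to_subtype
  have hRT : 0 < 1 + 2 * (R * T) := by positivity
  -- The infimum need not be attained, so the estimate is solved for the distance and proved for
  -- each `u`.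
  have hinf : (‖f (g x + e) - x‖ - δ * ‖x‖ - 3 * T * ‖e‖) / (1 + 2 * (R * T)) ≤
      normDistance normII x U := by
    refine le_ciInf fun u => ?_
    rw [div_le_iff₀ hRT]
    have h1 := hf (g x + e) u u.2
    have h2 : ‖g x + e - g u‖ ≤ R * normII (x - u) + ‖e‖ := by
      rw [add_sub_right_comm]
      exact (norm_add_le _ _).trans (by linarith [hR' x u])
    have h3 : ‖g x + e‖ ≤ R * C * ‖x‖ + ‖e‖ := (norm_add_le _ _).trans (by linarith [hgx x])
    have h4 := norm_sub_le_norm_sub_add_norm_sub (f (g x + e)) u x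
    have h5 : ‖(u : EuclideanSpace ℝ (Fin n)) - x‖ ≤ normII (x - u) :=
      norm_sub_rev x (u : EuclideanSpace ℝ (Fin n)) ▸ h_normII _
    have h6 := mul_le_mul_of_nonneg_left h2 (by positivity : 0 ≤ 2 * T)
    have h7 := mul_le_mul_of_nonneg_left h3 hε0
    have h8 := mul_le_mul_of_nonneg_right hεδ (norm_nonneg x)
    have h9 := mul_le_mul_of_nonneg_right hεT (norm_nonneg e)
    linarith
  rw [div_le_iff₀ hRT] at hinf
  linarith
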